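/- For $i\in\{0,1,2\}$ and a point $p$ in the plane, let $C_0^p, C_1^p, C_2^p$ be the three cones with apex $p$ bounded by the rays from $p$ whose directions are the multiples of $2\pi/3$ from the negative $y$-axis, labelled clockwise so that $C_0^p$ is bisected by the upward vertical ray from $p$. Let $P$ be a finite non-empty set of points in the plane such that no two points of $P$ lie on a line parallel to the boundary of a cone or perpendicular to the angular bisector of a cone. Let $Y_3$ be the undirected graph with vertex set $P$ in which, for every $p\in P$ and every $i\in\{0,1,2\}$ such that $C_i^p$ contains a point of $P\setminus\{p\}$, the point $p$ is joined by an edge to a point of $P\setminus\{p\}$ in $C_i^p$ closest to $p$ in the Euclidean distance (if several points are at the same minimal distance, one of them is chosen arbitrarily), and which has no other edges. Then, however ties are broken, the graph $Y_3$ is connected. -/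

import Mathlib

noncomputable section

namespace Yao3

/-- The Euclidean plane. -/
abbrev Plane : Type := EuclideanSpace ℝ (Fin 2)

/-- The unit vector at angle `k * 2π/3`, measured clockwise from the negative `y`-axis. -/
def ray (k : ℕ) : Plane :=
  !₂[-Real.sin (k * (2 * Real.pi / 3)), -Real.cos (k * (2 * Real.pi / 3))]

/-- The cone `C_i` with apex `p`: the closed region between the two rays from `p` in the directions
`ray (i + 1)` and `ray (i + 2)`. Thus `C_0` is bisected by the positive `y`-axis at `p`, and
`C_0`, `C_1`, `C_2` follow each other in clockwise order. -/
def cone (i : Fin 3) (p : Plane) : Set Plane :=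
  {q | ∃ a b : ℝ, 0 ≤ a ∧ 0 ≤ b ∧ q - p = a • ray (i + 1) + b • ray (i + 2)}

/-- The direction of the angular bisector of `C_i` (the sum of the unit vectors that span the two
boundary rays). -/
def bisector (i : Fin 3) : Plane := ray (i + 1) + ray (i + 2)

/-- General position: no two points of `P` lie on a line parallel to the boundary of a cone or
perpendicular to the angular bisector of a cone. -/
def GeneralPosition (P : Finset Plane) : Prop :=
  ∀ p ∈ P, ∀ q ∈ P, p ≠ q →
    (∀ k : Fin 3, ¬ ∃ c : ℝ, q - p = c • ray k) ∧
    (∀ i : Fin 3, inner ℝ (q - p) (bisector i) ≠ 0)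

/-- `q` is a point of `P` closest to `p`, in the Euclidean distance, among the points of `P` other
than `p` in the `i`-cone of `p`. -/
def IsClosest (P : Finset Plane) (i : Fin 3) (p q : P) : Prop :=
  q ≠ p ∧ (q : Plane) ∈ cone i p ∧
    ∀ r : P, r ≠ p → (r : Plane) ∈ cone i p → dist (p : Plane) q ≤ dist (p : Plane) r

/-- `s p i` is a closest point to `p` in its `i`-cone, and `none` precisely when that cone holds
no other point of `P`. There is exactly one such `s` when no point of `P` is equidistant from two
others in a common cone; otherwise ties are broken arbitrarily by `s`. -/
def IsClosestChoice (P : Finset Plane) (s : P → Fin 3 → Option P) : Prop :=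
  ∀ (p : P) (i : Fin 3),
    (∀ q : P, s p i = some q → IsClosest P i p q) ∧
    (s p i = none → ∀ q : P, q ≠ p → (q : Plane) ∉ cone i p)

/-- The (undirected) Yao graph with three cones: every point is joined to its closest point in each
of its cones. -/
def yaoGraph (P : Finset Plane) (s : P → Fin 3 → Option P) : SimpleGraph P :=
  SimpleGraph.fromRel (fun p q => ∃ i : Fin 3, s p i = some q)

end Yao3

end

noncomputable section

namespace Yao3

/-! Suppose the graph is disconnected, and among pairs in different components let `p`, `q` minimise
the hexagonal distance, not the Euclidean one. Then `q` lies in some cone `i` of `p`, and `p` in a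
different cone `j` of `q`; let `r`, `t` be the neighbours that `p`, `q` choose there. The pairs `(r,
q)`, `(p, t)` and `(r, t)` are also disconnected, so none is hexagonally closer than `(p, q)`. Since
neither chosen edge is longer than `pq`, the first two bounds force both edges to lean towards the
third direction `ray k` (`hexagon_step`). Two such sideways steps bring `r` and `t` too close
together, against the third bound (`hexagon_steps_contradiction`). -/

/-- The inner product of a vector with the `k`-th boundary direction. -/
def coord (k : Fin 3) (v : Plane) : ℝ := inner ℝ v (ray k)

/-- The hexagonal norm of the plane whose unit ball has its sides perpendicular to the differences
of the boundary directions. -/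
def hexNorm (v : Plane) : ℝ :=
  (Finset.univ : Finset (Fin 3 × Fin 3)).sup' Finset.univ_nonempty
    (fun z => coord z.2 v - coord z.1 v)

lemma ray_zero : ray 0 = !₂[0, -1] := by
  simp [ray]

lemma ray_one : ray 1 = !₂[-(√3 / 2), 1 / 2] := by
  have h : (2 * Real.pi / 3 : ℝ) = Real.pi - Real.pi / 3 := by ring
  simp [ray, h, Real.sin_pi_sub, Real.cos_pi_sub]

lemma ray_two : ray 2 = !₂[√3 / 2, 1 / 2] := by
  have h : (2 * (2 * Real.pi / 3) : ℝ) = Real.pi / 3 + Real.pi := by ring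
  simp [ray, h, Real.sin_add_pi, Real.cos_add_pi]

lemma ray_add_three (k : ℕ) : ray (k + 3) = ray k := by
  have h : ((k + 3 : ℕ) : ℝ) * (2 * Real.pi / 3) = k * (2 * Real.pi / 3) + 2 * Real.pi := by
    push_cast; ring
  simp only [ray, h, Real.sin_add_two_pi, Real.cos_add_two_pi]

lemma coord_zero (v : Plane) : coord 0 v = -v 1 := by
  simp [coord, ray_zero, PiLp.inner_apply, Fin.sum_univ_two]

lemma coord_one (v : Plane) : coord 1 v = -(√3 / 2) * v 0 + v 1 / 2 := by
  simp [coord, ray_one, PiLp.inner_apply, Fin.sum_univ_two]; ring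

lemma coord_two (v : Plane) : coord 2 v = √3 / 2 * v 0 + v 1 / 2 := by
  simp [coord, ray_two, PiLp.inner_apply, Fin.sum_univ_two]; ring

lemma coord_sub (k : Fin 3) (v w : Plane) : coord k (v - w) = coord k v - coord k w :=
  inner_sub_left _ _ _

lemma plane_ext {v w : Plane} (h0 : v 0 = w 0) (h1 : v 1 = w 1) : v = w := by
  ext i; fin_cases i <;> assumption

lemma eq_sum_coord_smul_ray (v : Plane) :
    v = (2 / 3 * coord 0 v) • ray 0 + (2 / 3 * coord 1 v) • ray 1
      + (2 / 3 * coord 2 v) • ray 2 := by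
  have h3 : √3 * √3 = 3 := Real.mul_self_sqrt (by norm_num)
  apply plane_ext <;>
    simp [ray_zero, ray_one, ray_two, coord_zero, coord_one, coord_two]
  · linear_combination (-v 0 / 3) * h3
  · ring

lemma ray_sum : ray 0 + ray 1 + ray 2 = 0 := by
  apply plane_ext <;> simp [ray_zero, ray_one, ray_two]
  norm_num

lemma exists_smul_ray_of_coord_eq {i j k : Fin 3} (hij : i ≠ j) (hik : i ≠ k) (hjk : j ≠ k)
    {v : Plane} (h : coord i v = coord j v) : ∃ c : ℝ, v = c • ray k := by
  have hv := eq_sum_coord_smul_ray v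
  have hs : ray 0 = -ray 1 - ray 2 := by
    rw [← sub_eq_zero, ← ray_sum]; abel
  refine ⟨2 / 3 * (coord k v - coord i v), ?_⟩
  fin_cases i <;> fin_cases j <;> fin_cases k <;> simp at hij hik hjk h ⊢ <;>
    (nth_rw 1 [hv]; simp only [h, hs]; module)

lemma norm_sq_eq {i j k : Fin 3} (hij : i ≠ j) (hik : i ≠ k) (hjk : j ≠ k) (v : Plane) :
    ‖v‖ ^ 2 = 4 / 9 * ((coord j v - coord k v) ^ 2
      + (coord j v - coord k v) * (coord k v - coord i v) + (coord k v - coord i v) ^ 2) := by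
  have h3 : √3 ^ 2 = 3 := Real.sq_sqrt (by norm_num)
  have h : ‖v‖ ^ 2 = v 0 ^ 2 + v 1 ^ 2 := by
    rw [EuclideanSpace.norm_sq_eq]; simp [Fin.sum_univ_two]
  rw [h]
  fin_cases i <;> fin_cases j <;> fin_cases k <;> simp at hij hik hjk ⊢ <;>
    simp only [coord_zero, coord_one, coord_two] <;> ring_nf <;> simp only [h3] <;> ring

/-- The three rays sum to zero, so `ray i` can be eliminated from the expansion of `q - p`; the
remaining coefficients are multiples of the differences with `coord i`. -/
lemma mem_cone_iff (i : Fin 3) (p q : Plane) :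
    q ∈ cone i p ↔ ∀ k, coord i (q - p) ≤ coord k (q - p) := by
  have h3 : √3 * √3 = 3 := Real.mul_self_sqrt (by norm_num)
  have hs : ray 0 = -ray 1 - ray 2 := by
    rw [← sub_eq_zero, ← ray_sum]; abel
  have r3 : ray 3 = ray 0 := ray_add_three 0
  have r4 : ray 4 = ray 1 := ray_add_three 1
  have hv := eq_sum_coord_smul_ray (q - p)
  constructor
  · rintro ⟨a, b, ha, hb, h⟩ k
    rw [h]
    fin_cases i <;> fin_cases k <;>
      simp [coord_zero, coord_one, coord_two, ray_zero, ray_one, ray_two, r3, r4] <;> nlinarith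
  · intro h
    refine ⟨2 / 3 * (coord (i + 1) (q - p) - coord i (q - p)),
      2 / 3 * (coord (i + 2) (q - p) - coord i (q - p)), ?_, ?_, ?_⟩
    · have := h (i + 1); linarith
    · have := h (i + 2); linarith
    · nth_rw 1 [hv]
      fin_cases i <;> simp [r3, r4, hs] <;> module

lemma coord_sub_coord_le_hexNorm (i j : Fin 3) (v : Plane) : coord j v - coord i v ≤ hexNorm v :=
  Finset.le_sup' (fun z : Fin 3 × Fin 3 => coord z.2 v - coord z.1 v) (Finset.mem_univ (i, j))

lemma exists_hexNorm_eq (v : Plane) : ∃ i j, hexNorm v = coord j v - coord i v := by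
  obtain ⟨z, -, hz⟩ := Finset.exists_mem_eq_sup' (Finset.univ_nonempty)
    (fun z : Fin 3 × Fin 3 => coord z.2 v - coord z.1 v)
  exact ⟨z.1, z.2, hz⟩

lemma le_abs_of_le_hexNorm {i j k : Fin 3} (hij : i ≠ j) (hik : i ≠ k) (hjk : j ≠ k)
    {S : ℝ} (hS : 0 < S) {v : Plane} (h : S ≤ hexNorm v) :
    S ≤ |coord j v - coord k v| ∨ S ≤ |coord k v - coord i v| ∨ S ≤ |coord j v - coord i v| := by
  obtain ⟨m, n, hmn⟩ := exists_hexNorm_eq v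
  have h' : S ≤ |coord n v - coord m v| := (hmn ▸ h).trans (le_abs_self _)
  have hne : n ≠ m := by rintro rfl; simp at h'; linarith
  have hcov : ∀ l : Fin 3, l = i ∨ l = j ∨ l = k := by
    revert i j k; decide
  rcases hcov m with rfl | rfl | rfl <;> rcases hcov n with rfl | rfl | rfl <;>
    first
      | exact absurd rfl hne
      | (simp only [h', true_or, or_true])
      | (rw [abs_sub_comm] at h'; simp only [h', true_or, or_true])

/-- In coordinates with respect to two unit vectors at angle `π/3`: if the step `(x₁ - x₂, x₂)` is no
longer than the vector `(a, b)`, but subtracting it does not bring that vector into the interior of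
the hexagon of radius `a + b`, then the coefficient `x₂` is large compared with `x₁`. -/
lemma hexagon_step {a b x₁ x₂ : ℝ} (ha : 0 < a) (hb : 0 < b) (hx₁ : 0 < x₁)
    (hx₂ : 0 ≤ x₂) (hx : x₁ ^ 2 - x₁ * x₂ + x₂ ^ 2 ≤ a ^ 2 + a * b + b ^ 2)
    (h : a + b ≤ |a - x₁ + x₂| ∨ a + b ≤ |b - x₂| ∨ a + b ≤ |a + b - x₁|) :
    b + x₁ ≤ x₂ ∧ x₂ < a + b + x₁ ∧ x₂ < 2 * (a + b) := by
  have hab : 0 ≤ a * b := (mul_pos ha hb).le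
  have hx2lt : x₂ < 2 * (a + b) := by nlinarith [sq_nonneg (x₁ - x₂ / 2)]
  have hx1lt : x₁ < 2 * (a + b) := by nlinarith [sq_nonneg (x₂ - x₁ / 2)]
  have hlt : x₂ < a + b + x₁ := by
    by_contra hcon
    nlinarith [mul_nonneg hx₂ hx₁.le]
  refine ⟨?_, hlt, hx2lt⟩
  rcases h with h | h | h <;> rcases le_abs.1 h with h | h
  · linarith
  · have ht : 2 * a + b ≤ x₁ - x₂ := by linarith
    nlinarith [mul_nonneg hx₂ hx₁.le, pow_le_pow_left₀ (by linarith) ht 2]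
  · linarith
  -- Here `x₂ ≥ a + 2 * b`. If also `x₁ > x₂ - b`, then `x₁ - x₂ / 2 > a / 2`, and completing the
  -- square makes the step too long.
  · by_contra hcon
    nlinarith
  · linarith
  · linarith

/-- The steps from the two ends satisfy `x₂ ≥ b + x₁` and `y₁ ≥ a + y₂`, so their large components,
along the same direction, nearly cancel in the difference of the endpoints. -/
lemma hexagon_steps_contradiction {a b x₁ x₂ y₁ y₂ : ℝ} (ha : 0 < a) (hb : 0 < b)
    (hx₁ : 0 < x₁) (hx₂ : 0 ≤ x₂) (hy₁ : 0 ≤ y₁) (hy₂ : 0 < y₂)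
    (hx : x₁ ^ 2 - x₁ * x₂ + x₂ ^ 2 ≤ a ^ 2 + a * b + b ^ 2)
    (hy : y₂ ^ 2 - y₂ * y₁ + y₁ ^ 2 ≤ a ^ 2 + a * b + b ^ 2)
    (h₁ : a + b ≤ |a - x₁ + x₂| ∨ a + b ≤ |b - x₂| ∨ a + b ≤ |a + b - x₁|)
    (h₂ : a + b ≤ |a - y₁| ∨ a + b ≤ |b - y₂ + y₁| ∨ a + b ≤ |a + b - y₂|)
    (h₃ : a + b ≤ |a - x₁ + x₂ - y₁| ∨ a + b ≤ |b - x₂ + y₁ - y₂| ∨ a + b ≤ |a + b - x₁ - y₂|) :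
    False := by
  obtain ⟨hx3, hx4, hx5⟩ := hexagon_step ha hb hx₁ hx₂ hx h₁
  -- Exchanging the two ends swaps `a` with `b`.
  obtain ⟨hy3, hy4, hy5⟩ := hexagon_step hb ha hy₂ hy₁ (by linarith)
    (by simpa only [add_comm b a] using or_left_comm.1 h₂)
  have hx6 : x₁ < a + b := by nlinarith [mul_pos ha hb]
  have hy6 : y₂ < a + b := by nlinarith [mul_pos ha hb]
  rcases h₃ with h | h | h <;> rcases le_abs.1 h with h | h <;> linarith

lemma coord_ne_coord {P : Finset Plane} (hP : GeneralPosition P) {p q : Plane} (hp : p ∈ P)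
    (hq : q ∈ P) (hpq : p ≠ q) {i j : Fin 3} (hij : i ≠ j) :
    coord i (q - p) ≠ coord j (q - p) := by
  intro h
  obtain ⟨k, hik, hjk⟩ : ∃ k, i ≠ k ∧ j ≠ k := by
    clear * - hij
    revert i j; decide
  exact (hP p hp q hq hpq).1 k (exists_smul_ray_of_coord_eq hij hik hjk h)

lemma exists_edge_in_cone {P : Finset Plane} {s : P → Fin 3 → Option P}
    (hs : IsClosestChoice P s) {p q : P} {i : Fin 3} (hne : q ≠ p) (hq : (q : Plane) ∈ cone i p) :
    ∃ r : P, r ≠ p ∧ (r : Plane) ∈ cone i p ∧ ‖(r : Plane) - p‖ ≤ ‖(q : Plane) - p‖ ∧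
      (yaoGraph P s).Adj p r := by
  obtain ⟨hsome, hnone⟩ := hs p i
  cases h : s p i with
  | none => exact absurd hq (hnone h q hne)
  | some r =>
    obtain ⟨hr1, hr2, hr3⟩ := hsome r h
    refine ⟨r, hr1, hr2, ?_, ?_⟩
    · simpa only [dist_eq_norm'] using hr3 q hne hq
    · rw [yaoGraph, SimpleGraph.fromRel_adj]
      exact ⟨hr1.symm, Or.inl ⟨i, h⟩⟩

lemma reachable_of_forall_hexNorm_le {P : Finset Plane} (hP : GeneralPosition P)
    {s : P → Fin 3 → Option P} (hs : IsClosestChoice P s) (p q : P)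
    (hmin : ∀ p' q' : P, ¬ (yaoGraph P s).Reachable p' q' →
      hexNorm ((q : Plane) - p) ≤ hexNorm ((q' : Plane) - p')) :
    (yaoGraph P s).Reachable p q := by
  by_contra hpq
  have hne : q ≠ p := by rintro rfl; exact hpq (SimpleGraph.Reachable.refl _)
  have hne' : ∀ {a b : P}, a ≠ b → (a : Plane) ≠ b := fun h h' => h (Subtype.ext h')
  obtain ⟨i, j, hd⟩ := exists_hexNorm_eq ((q : Plane) - p)
  have hle := fun m n => (coord_sub_coord_le_hexNorm m n ((q : Plane) - p)).trans_eq hd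
  have hij : i ≠ j := by
    rintro rfl
    have h1 := hle 0 1
    have h2 := hle 1 0
    exact coord_ne_coord hP p.2 q.2 (hne' hne.symm) (show (0 : Fin 3) ≠ 1 by decide) (by linarith)
  obtain ⟨k, hik, hjk⟩ : ∃ k, i ≠ k ∧ j ≠ k := by
    clear * - hij
    revert i j; decide
  -- `i` is the least coordinate of `q - p` and `j` the greatest; negation reverses the order.
  have hqp : (q : Plane) ∈ cone i p := by
    rw [mem_cone_iff]; intro m; have := hle m j; linarith
  have hcq : (p : Plane) ∈ cone j q := by
    rw [mem_cone_iff]; intro m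
    have := hle i m
    simp only [coord_sub] at this ⊢; linarith
  obtain ⟨r, hr, hrc, hrn, hradj⟩ := exists_edge_in_cone hs hne hqp
  obtain ⟨t, ht, htc, htn, htadj⟩ := exists_edge_in_cone hs hne.symm hcq
  have hS : 0 < coord j ((q : Plane) - p) - coord i ((q : Plane) - p) := by
    have h1 := hle j i
    have h2 := coord_ne_coord hP p.2 q.2 (hne' hne.symm) hij
    exact lt_of_le_of_ne (by linarith) (fun h => h2 (by linarith))
  have key : ∀ p' q' : P, ¬ (yaoGraph P s).Reachable p' q' → _ := fun p' q' h =>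
    le_abs_of_le_hexNorm hij hik hjk hS (hd ▸ hmin p' q' h)
  have hrq := key r q fun h => hpq (hradj.reachable.trans h)
  have hpt := key p t fun h => hpq (h.trans htadj.symm.reachable)
  have hrt := key r t fun h => hpq ((hradj.reachable.trans h).trans htadj.symm.reachable)
  have hrn' := pow_le_pow_left₀ (norm_nonneg _) hrn 2
  have htn' := pow_le_pow_left₀ (norm_nonneg _) htn 2
  rw [norm_sub_rev (p : Plane) q] at htn'
  rw [norm_sq_eq hij hik hjk, norm_sq_eq hij hik hjk] at hrn' htn'
  rw [mem_cone_iff] at hrc htc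
  have hx1 := lt_of_le_of_ne (hrc j) (coord_ne_coord hP p.2 r.2 (hne' hr.symm) hij)
  have hy2 := lt_of_le_of_ne (htc i) (coord_ne_coord hP q.2 t.2 (hne' ht.symm) hij.symm)
  have hx2 := hrc k
  have hy1 := htc k
  have ha := lt_of_le_of_ne (hle i k) fun h =>
    coord_ne_coord hP p.2 q.2 (hne' hne.symm) hjk (by linarith)
  have hb := lt_of_le_of_ne (hle k j) fun h =>
    coord_ne_coord hP p.2 q.2 (hne' hne.symm) hik (by linarith)
  simp only [coord_sub] at *
  -- Up to the factor `2 / 3`, `r - p` is `x₁ • ray j + x₂ • ray k` and `t - q` is `y₂ • ray i + y₁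
  -- • ray k`; `a + b` is the hexagonal norm of `q - p`.
  apply hexagon_steps_contradiction
    (a := (coord j q - coord j p) - (coord k q - coord k p))
    (b := (coord k q - coord k p) - (coord i q - coord i p))
    (x₁ := (coord j r - coord j p) - (coord i r - coord i p))
    (x₂ := (coord k r - coord k p) - (coord i r - coord i p))
    (y₁ := (coord k t - coord k q) - (coord j t - coord j q))
    (y₂ := (coord i t - coord i q) - (coord j t - coord j q)) <;>
    first
      | linarith
      | nlinarith
      | (ring_nf at hrq hpt hrt ⊢; assumption)

end Yao3

end

/-- The Yao graph with three cones of a finite point set in general position is connected. -/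
theorem theorem2 (P : Finset Yao3.Plane) (hne : P.Nonempty) (hP : Yao3.GeneralPosition P)
    (s : P → Fin 3 → Option P) (hs : Yao3.IsClosestChoice P s) :
    (Yao3.yaoGraph P s).Connected := by
  classical
  have : Nonempty P := hne.to_subtype
  refine ⟨?_⟩
  by_contra hcon
  simp only [SimpleGraph.Preconnected, not_forall] at hcon
  obtain ⟨p₀, q₀, h₀⟩ := hcon
  obtain ⟨⟨p, q⟩, hz, hmin⟩ := Finset.exists_min_image
    (Finset.univ.filter fun z : P × P => ¬ (Yao3.yaoGraph P s).Reachable z.1 z.2)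
    (fun z => Yao3.hexNorm ((z.2 : Yao3.Plane) - z.1)) ⟨(p₀, q₀), by simpa using h₀⟩
  refine (Finset.mem_filter.1 hz).2 (Yao3.reachable_of_forall_hexNorm_le hP hs p q ?_)
  exact fun p' q' h => hmin (p', q') (by simpa using h)
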